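/- For $n \ge 0$ let $H^n$ be the split union of $n$ Hopf links $(r_j, b_j)$, $1 \le j \le n$: the smooth link type in $\mathbb{R}^3$ (unoriented components, up to smooth ambient isotopy respecting the labels) with $2n$ components $r_1,\dots,r_n,b_1,\dots,b_n$, in which each $r_j \cup b_j$ is a Hopf link and lies in a ball of its own, these $n$ balls being disjoint. A diagonal-$\epsilon$-embedding of $H^n$ into the unit cube is a link of this type that is contained in $[0,1]^3$ and satisfies $\operatorname{dist}(r_j, b_j) \ge \epsilon$ for every $j$ (no distance is prescribed between other pairs of components). Then there are constants $a > 0$ and $C > 0$ such that for every $\epsilon > 0$ and every $n$ for which $H^n$ has a diagonal-$\epsilon$-embedding into the unit cube, $$ n \le C\, e^{a \epsilon^{-3}} . $$ In particular the largest such $n = n(\epsilon)$ is finite and $n(\epsilon) = O(e^{a\epsilon^{-3}})$ as $\epsilon \to 0$. -/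

import Mathlib

open scoped Manifold ContDiff

noncomputable section

/-- Euclidean 3-space. -/
abbrev E3 : Type := EuclideanSpace ℝ (Fin 3)

/-- The closed unit cube `[0,1]³`. -/
def unitCube : Set E3 := {x | ∀ i, x i ∈ Set.Icc (0 : ℝ) 1}

/-- A (smooth) link in `ℝ³` with components indexed by `ι`: smoothly embedded circles with
pairwise disjoint images. -/
structure IsLink {ι : Type*} (K : ι → Circle → E3) : Prop where
  smoothEmbedding : ∀ i, Manifold.IsSmoothEmbedding (𝓡 1) 𝓘(ℝ, E3) ∞ (K i)
  disjoint : ∀ i j, i ≠ j → Disjoint (Set.range (K i)) (Set.range (K j))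

/-- Two links (with labelled, unoriented components) have the same link type: a smooth ambient
isotopy `Φ` of `ℝ³`, starting at the identity, ends at a diffeomorphism that takes every component
of `K` onto the component of `L` with the same label. -/
def SameLinkType {ι : Type*} (K L : ι → Circle → E3) : Prop :=
  ∃ Φ : ℝ → E3 ≃ₘ^∞⟮𝓘(ℝ, E3), 𝓘(ℝ, E3)⟯ E3,
    ContDiff ℝ ∞ (fun p : ℝ × E3 => Φ p.1 p.2) ∧
    (∀ x, Φ 0 x = x) ∧
    ∀ i, Φ 1 '' Set.range (K i) = Set.range (L i)

/-- The component `r_j` of the model of the split union of Hopf links: the unit circle with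
centre `(4j, 0, 0)` in the plane `z = 0`. -/
def hopfRed {n : ℕ} (j : Fin n) (z : Circle) : E3 :=
  !₂[4 * (j : ℝ) + (z : ℂ).re, (z : ℂ).im, 0]

/-- The component `b_j` of the model: the unit circle with centre `(4j + 1, 0, 0)` in the plane
`y = 0`. It forms a Hopf link with `r_j`. The `j`-th Hopf link is inside the round sphere with
centre `(4j + 1/2, 0, 0)` and radius `7/4`, and these spheres bound disjoint balls. -/
def hopfBlue {n : ℕ} (j : Fin n) (z : Circle) : E3 :=
  !₂[4 * (j : ℝ) + 1 + (z : ℂ).re, 0, (z : ℂ).im]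

/-- The model of the split union `Hⁿ` of `n` Hopf links `(r_j, b_j)`: the components `r_j` are
labelled by the left summand, the components `b_j` by the right summand. -/
def hopfSplitUnion (n : ℕ) : Fin n ⊕ Fin n → Circle → E3 :=
  Sum.elim hopfRed hopfBlue

/-- The circles `r_j`, `b_j` form a diagonal-`ε`-embedding of `Hⁿ` into the unit cube. -/
structure IsDiagonalEmbedding (ε : ℝ) {n : ℕ} (r b : Fin n → Circle → E3) : Prop where
  isLink : IsLink (Sum.elim r b)
  linkType : SameLinkType (hopfSplitUnion n) (Sum.elim r b)
  red_mem : ∀ j z, r j z ∈ unitCube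
  blue_mem : ∀ j z, b j z ∈ unitCube
  le_dist : ∀ j z w, ε ≤ dist (r j z) (b j w)

end

/-!
Only the final diffeomorphism `φ` of the isotopy matters: it carries the model circles onto the
link. The function `blueFun j` on `ℝ³` vanishes exactly on the `j`-th blue circle of the model, so
`G = blueFun j ∘ φ⁻¹` vanishes only on `b_j`. The monodromy (a sign) of the square root of `G` along
a loop in the complement of `b_j` is the linking number mod 2 of the loop with `b_j`. In the model
it can be computed explicitly: it is `-1` along `r_j` (`exists_sqrt_blueFun_self`) and `+1` along
`r_k` for `k ≠ j` (`exists_sqrt_blueFun_of_ne`).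

Divide the cube into cells of side `1 / N`, where `N` is about `7 / ε`. To each index `k` belong

* the parity, for each of the at most `27 (N + 1)³` pairs of adjacent cells, of the number of times
  that `r_k` steps from the first cell to the second one;
* the set of cells that `b_k` visits.

Together these take at most `2 ^ (28 (N + 1)³)` values. They determine the index `k`: suppose that
`j ≠ k` have the same data. Then `b_j` visits the same cells as `b_k`, so it keeps away from the
boxes around the cells on `r_k`, as it does from the boxes around the cells on `r_j`. On every such
box `G` has a continuous square root, and comparing these square roots on adjacent boxes gives a
sign cochain whose product along the steps of a loop is the monodromy (`exists_sign_cochain`). That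
product depends only on the parities of the numbers of steps, so it is the same for `r_j` and `r_k`;
but it should be `-1` for one and `+1` for the other. Hence
`n ≤ 2 ^ (28 (N + 1)³) ≤ exp (28 (N + 1)³)` (`card_le_of_homeomorph`).
-/

/-! ### Boxes around lattice cells -/

/-- The open box of side `4 / N` centred at the lattice point `c / N`. -/
def latticeBox (N : ℕ) (c : Fin 3 → ℤ) : Set E3 := {x | ∀ i, |(N : ℝ) * x i - c i| < 2}

/-- The lattice cell of side `1 / N` that contains `x`, given by its lower corner. -/
noncomputable def latticeCell (N : ℕ) (x : E3) : Fin 3 → ℤ := fun i => ⌊(N : ℝ) * x i⌋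

theorem convex_latticeBox (N : ℕ) (c : Fin 3 → ℤ) : Convex ℝ (latticeBox N c) := by
  intro x hx y hy a b ha hb hab i
  have hx := abs_lt.1 (hx i)
  have hy := abs_lt.1 (hy i)
  simp only [PiLp.add_apply, PiLp.smul_apply, smul_eq_mul]
  have hb' : b = 1 - a := by linarith
  subst hb'
  rw [abs_lt]
  rcases eq_or_lt_of_le ha with rfl | ha'
  · simp only [zero_mul, zero_add, sub_zero, one_mul]; exact hy
  · constructor <;> nlinarith

theorem isOpen_latticeBox (N : ℕ) (c : Fin 3 → ℤ) : IsOpen (latticeBox N c) := by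
  have : latticeBox N c = ⋂ i, {x : E3 | |(N : ℝ) * x i - c i| < 2} := by
    ext; simp [latticeBox]
  rw [this]
  exact isOpen_iInter_of_finite fun i => isOpen_lt (by fun_prop) continuous_const

/-- A sufficiently fine subdivision of a path: the path stays in the box around the cell of the
`i`-th point of subdivision until the next one is reached, and consecutive cells are adjacent. The
case `i = m`, which concerns the interval that starts at `1`, is included because loops are
parametrized here by periodic functions on `ℝ`. -/
theorem exists_subdivision (N : ℕ) {γ : ℝ → E3} (hγ : Continuous γ) :
    ∃ m : ℕ, 0 < m ∧ ∀ i ≤ m,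
      (∀ x ∈ Set.Icc ((i : ℝ) / m) ((i + 1 : ℕ) / m),
        γ x ∈ latticeBox N (latticeCell N (γ (i / m)))) ∧
      ∀ l, |latticeCell N (γ ((i + 1 : ℕ) / m)) l - latticeCell N (γ (i / m)) l| ≤ 1 := by
  -- The interval `[0, 2]` leaves room for the step after the one that ends at `1`.
  have huc := isCompact_Icc.uniformContinuousOn_of_continuous
    (hγ.continuousOn (s := Set.Icc (0 : ℝ) 2))
  obtain ⟨δ, hδ, h⟩ := Metric.uniformContinuousOn_iff.1 huc (1 / (N + 1)) (by positivity)
  obtain ⟨m, hm⟩ := exists_nat_one_div_lt hδ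
  have hm0 : (0 : ℝ) < (m + 1 : ℕ) := by positivity
  have hclose : ∀ i ≤ m + 1, ∀ x ∈ Set.Icc ((i : ℝ) / (m + 1 : ℕ)) ((i + 1 : ℕ) / (m + 1 : ℕ)),
      ∀ l, |(N : ℝ) * γ x l - N * γ (i / (m + 1 : ℕ)) l| < 1 := by
    intro i hi x hx l
    have hi' : (i : ℝ) ≤ (m + 1 : ℕ) := by exact_mod_cast hi
    have h1 : (i : ℝ) / (m + 1 : ℕ) ≤ 1 := (div_le_one hm0).2 hi'
    have h2 : ((i + 1 : ℕ) : ℝ) / (m + 1 : ℕ) = i / (m + 1 : ℕ) + 1 / (m + 1) := by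
      push_cast; rw [add_div]
    have h3 : (1 : ℝ) / (m + 1) ≤ 1 := by
      rw [div_le_one (by positivity)]; linarith [(Nat.cast_nonneg m : (0 : ℝ) ≤ m)]
    have h0 : (0 : ℝ) ≤ (i : ℝ) / (m + 1 : ℕ) := by positivity
    rw [h2] at hx
    have hd := h x ⟨by linarith [hx.1], by linarith [hx.2]⟩ (i / (m + 1 : ℕ)) ⟨h0, by linarith⟩
      (by rw [Real.dist_eq, abs_of_nonneg (by linarith [hx.1])]; linarith [hx.2])
    rw [dist_eq_norm] at hd
    have hl := (PiLp.norm_apply_le (γ x - γ (i / (m + 1 : ℕ))) l).trans_lt hd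
    rw [PiLp.sub_apply, Real.norm_eq_abs, lt_div_iff₀ (by positivity)] at hl
    rw [← mul_sub, abs_mul, Nat.abs_cast]
    nlinarith [abs_nonneg (γ x l - γ (i / (m + 1 : ℕ)) l)]
  refine ⟨m + 1, Nat.succ_pos m, fun i hi => ⟨fun x hx l => ?_, fun l => ?_⟩⟩
  · have h1 := abs_lt.1 (hclose i hi x hx l)
    have h2 := Int.floor_le ((N : ℝ) * γ (i / (m + 1 : ℕ)) l)
    have h3 := Int.lt_floor_add_one ((N : ℝ) * γ (i / (m + 1 : ℕ)) l)
    simp only [latticeCell]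
    rw [abs_lt]
    constructor <;> linarith
  · have h1 := abs_lt.1 (hclose i hi _ (Set.right_mem_Icc.2
      (by gcongr; exact i.le_succ)) l)
    simp only [latticeCell]
    have h2 := Int.floor_le ((N : ℝ) * γ (i / (m + 1 : ℕ)) l)
    have h3 := Int.lt_floor_add_one ((N : ℝ) * γ (i / (m + 1 : ℕ)) l)
    have h4 := Int.floor_le ((N : ℝ) * γ ((i + 1 : ℕ) / (m + 1 : ℕ)) l)
    have h5 := Int.lt_floor_add_one ((N : ℝ) * γ ((i + 1 : ℕ) / (m + 1 : ℕ)) l)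
    generalize ⌊(N : ℝ) * γ (i / (m + 1 : ℕ)) l⌋ = p at *
    generalize ⌊(N : ℝ) * γ ((i + 1 : ℕ) / (m + 1 : ℕ)) l⌋ = r at *
    have h6 : r < p + 2 := by exact_mod_cast (by linarith : (r : ℝ) < p + 2)
    have h7 : p < r + 2 := by exact_mod_cast (by linarith : (p : ℝ) < r + 2)
    rw [abs_le]
    constructor <;> linarith

/-- The labels of the cells that meet the unit cube: the label `N` is needed for points with a
coordinate equal to `1`. -/
abbrev CubeCell (N : ℕ) : Type := Fin 3 → Fin (N + 1)

/-- The ordered pairs of adjacent (or equal) cells whose first member meets the unit cube: the pair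
`(v, o)` stands for `v` and `v + o - (1, 1, 1)`. -/
abbrev CubeStep (N : ℕ) : Type := CubeCell N × (Fin 3 → Fin 3)

/-- The lattice point of a cell. -/
def CubeCell.toLattice {N : ℕ} (v : CubeCell N) : Fin 3 → ℤ := fun i => ((v i : ℕ) : ℤ)

/-- The second member of a pair of adjacent cells. -/
def CubeStep.target {N : ℕ} (e : CubeStep N) : Fin 3 → ℤ :=
  fun i => ((e.1 i : ℕ) : ℤ) + ((e.2 i : ℕ) : ℤ) - 1

theorem exists_cubeCell (N : ℕ) {x : E3} (hx : x ∈ unitCube) :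
    ∃ v : CubeCell N, v.toLattice = latticeCell N x := by
  have h0 : ∀ i, 0 ≤ ⌊(N : ℝ) * x i⌋ := fun i =>
    Int.floor_nonneg.2 (mul_nonneg (Nat.cast_nonneg N) (hx i).1)
  have h1 : ∀ i, ⌊(N : ℝ) * x i⌋ ≤ N := fun i => by
    have : ⌊(N : ℝ) * x i⌋ ≤ ⌊((N : ℤ) : ℝ)⌋ := Int.floor_mono (by
      push_cast; exact mul_le_of_le_one_right (Nat.cast_nonneg N) (hx i).2)
    rwa [Int.floor_intCast] at this
  refine ⟨fun i => ⟨⌊(N : ℝ) * x i⌋.toNat, by have := h0 i; have := h1 i; omega⟩, ?_⟩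
  funext i
  exact Int.toNat_of_nonneg (h0 i)

theorem exists_cubeStep (N : ℕ) {x y : E3} (hx : x ∈ unitCube)
    (h : ∀ l, |latticeCell N y l - latticeCell N x l| ≤ 1) :
    ∃ e : CubeStep N, e.1.toLattice = latticeCell N x ∧ e.target = latticeCell N y := by
  obtain ⟨v, hv⟩ := exists_cubeCell N hx
  have h' : ∀ l, -1 ≤ latticeCell N y l - latticeCell N x l ∧
      latticeCell N y l - latticeCell N x l ≤ 1 := fun l => abs_le.1 (h l)
  refine ⟨(v, fun l => ⟨(latticeCell N y l - latticeCell N x l + 1).toNat, by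
    have := h' l; omega⟩), hv, ?_⟩
  funext l
  have h1 := Int.toNat_of_nonneg (a := latticeCell N y l - latticeCell N x l + 1)
    (by have := h' l; omega)
  have h2 : ((v l : ℕ) : ℤ) = latticeCell N x l := congrFun hv l
  simp only [CubeStep.target]
  rw [h1, h2]
  ring

/-- If the box around the cell of `p` meets the cell of `y`, then `p` and `y` are at distance less
than `7 / N`. In each coordinate the distance is at most `4 / N`, and `4 * √3 < 7`. -/
theorem mul_dist_lt_seven {N : ℕ} {p x y : E3} (hx : x ∈ latticeBox N (latticeCell N p))
    (hxy : latticeCell N y = latticeCell N x) : (N : ℝ) * dist p y < 7 := by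
  have key : ∀ i, ((N : ℝ) * (p i - y i)) ^ 2 ≤ 16 := by
    intro i
    have h1 := abs_lt.1 (hx i)
    have h2 : ⌊(N : ℝ) * y i⌋ = ⌊(N : ℝ) * x i⌋ := congrFun hxy i
    have h3 := abs_lt.1 (Int.abs_sub_lt_one_of_floor_eq_floor h2)
    have h4 := Int.floor_le ((N : ℝ) * p i)
    have h5 := Int.lt_floor_add_one ((N : ℝ) * p i)
    simp only [latticeCell] at h1
    have : |(N : ℝ) * (p i - y i)| ≤ 4 := by
      rw [abs_le]; constructor <;> linarith
    nlinarith [abs_le.1 this]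
  have h : ((N : ℝ) * dist p y) ^ 2 < 7 ^ 2 := by
    rw [mul_pow, EuclideanSpace.dist_eq, Real.sq_sqrt (by positivity), Fin.sum_univ_three]
    simp only [Real.dist_eq, sq_abs]
    nlinarith [key 0, key 1, key 2]
  exact lt_of_pow_lt_pow_left₀ 2 (by norm_num) h

/-! ### Monodromy of square roots along loops -/

/-- A continuous complex function on `ℝ³` has a continuous square root on every box on which it does
not vanish. Two of them agree up to a sign on the intersection of their boxes; the signs form a
`±1`-valued cochain on pairs of boxes, and it computes the monodromy of the square root along
every loop covered by boxes without zeros. -/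
theorem exists_sign_cochain (N : ℕ) {G : E3 → ℂ} (hG : Continuous G) :
    ∃ σ : (Fin 3 → ℤ) → (Fin 3 → ℤ) → ℤˣ,
      ∀ (γ : ℝ → E3) (q : ℝ → ℂ) (t : ℕ → ℝ) (c : ℕ → Fin 3 → ℤ) (m : ℕ),
        Continuous γ → Continuous q → (∀ x, q x ^ 2 = G (γ x)) → Monotone t →
        (∀ i ≤ m, ∀ x ∈ Set.Icc (t i) (t (i + 1)), γ x ∈ latticeBox N (c i)) →
        (∀ i ≤ m, ∀ x ∈ latticeBox N (c i), G x ≠ 0) →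
        c m = c 0 → γ (t m) = γ (t 0) →
        q (t m) = ((∏ i ∈ Finset.range m, σ (c i) (c (i + 1)) : ℤˣ) : ℤ) * q (t 0) := by
  have hs : ∀ c : Fin 3 → ℤ, ∃ s : E3 → ℂ, (∀ x, s x ^ 2 = G x) ∧
      ((∀ x ∈ latticeBox N c, G x ≠ 0) → ContinuousOn s (latticeBox N c)) := by
    intro c
    by_cases h : (∀ x ∈ latticeBox N c, G x ≠ 0) ∧ (latticeBox N c).Nonempty
    · have := (convex_latticeBox N c).contractibleSpace h.2
      have hsc : IsSimplyConnected (latticeBox N c) :=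
        SimplyConnectedSpace.ofContractible _
      obtain ⟨s, hs, hs'⟩ := Complex.exists_continuousOn_pow_eq hsc (isOpen_latticeBox N c)
        hG.continuousOn (by rintro ⟨x, hx, h0⟩; exact h.1 x hx h0) two_ne_zero
      exact ⟨s, hs', fun _ => hs⟩
    · refine ⟨fun x => G x ^ (1 / 2 : ℂ), fun x => ?_, fun h' => ?_⟩
      · rw [← Complex.cpow_mul_nat]; simp
      · rw [Set.not_nonempty_iff_eq_empty.1 fun hne => h ⟨h', hne⟩]
        exact continuousOn_empty _
  choose s hs hsc using hs
  have hσ : ∀ c d : Fin 3 → ℤ, ∃ σ : ℤˣ, (∀ x ∈ latticeBox N c, G x ≠ 0) →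
      (∀ x ∈ latticeBox N d, G x ≠ 0) →
      ∀ x ∈ latticeBox N c ∩ latticeBox N d, s c x = ((σ : ℤ) : ℂ) * s d x := by
    intro c d
    by_cases h : (∀ x ∈ latticeBox N c, G x ≠ 0) ∧ (∀ x ∈ latticeBox N d, G x ≠ 0)
    · rcases ((convex_latticeBox N c).inter (convex_latticeBox N d)).isPreconnected
        |>.eq_or_eq_neg_of_sq_eq ((hsc c h.1).mono Set.inter_subset_left)
          ((hsc d h.2).mono Set.inter_subset_right) (fun x _ => by simp [hs])
          (fun {x} hx h0 => h.2 x hx.2 (by rw [← hs d, h0]; simp)) with h' | h'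
      · exact ⟨1, fun _ _ x hx => by simpa using h' hx⟩
      · exact ⟨-1, fun _ _ x hx => by simpa using h' hx⟩
    · exact ⟨1, fun h1 h2 => absurd ⟨h1, h2⟩ h⟩
  choose σ hσ using hσ
  refine ⟨σ, fun γ q t c m hγ hq hqG ht hbox hgood hcm hγm => ?_⟩
  have hcont : ∀ i ≤ m, ContinuousOn (fun x => s (c i) (γ x)) (Set.Icc (t i) (t (i + 1))) :=
    fun i hi => (hsc _ (hgood i hi)).comp hγ.continuousOn (hbox i hi)
  have hne : ∀ i ≤ m, ∀ x ∈ Set.Icc (t i) (t (i + 1)), s (c i) (γ x) ≠ 0 := fun i hi x hx h0 =>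
    hgood i hi _ (hbox i hi x hx) (by rw [← hs (c i), h0]; simp)
  have hsign : ∀ u : ℤˣ, (((u : ℤ) : ℂ)) ^ 2 = 1 := fun u => by
    rcases Int.units_eq_one_or u with rfl | rfl <;> simp
  obtain ⟨ρ, hρ⟩ : ∃ ρ : ℤˣ, q (t 0) = ((ρ : ℤ) : ℂ) * s (c 0) (γ (t 0)) := by
    rcases sq_eq_sq_iff_eq_or_eq_neg.1 ((hqG (t 0)).trans (hs (c 0) _).symm) with h | h
    · exact ⟨1, by simpa using h⟩
    · exact ⟨-1, by simpa using h⟩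
  -- The square roots `q` and `s (c i) ∘ γ` differ by a constant sign on the `i`-th interval.
  have key : ∀ i ≤ m, ∀ x ∈ Set.Icc (t i) (t (i + 1)),
      q x = ((ρ * ∏ l ∈ Finset.range i, σ (c l) (c (l + 1)) : ℤˣ) : ℤ) * s (c i) (γ x) := by
    have step : ∀ i ≤ m, ∀ u : ℤˣ, q (t i) = ((u : ℤ) : ℂ) * s (c i) (γ (t i)) →
        ∀ x ∈ Set.Icc (t i) (t (i + 1)), q x = ((u : ℤ) : ℂ) * s (c i) (γ x) := by
      intro i hi u hu
      refine isPreconnected_Icc.eq_of_sq_eq hq.continuousOn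
        (continuousOn_const.mul (hcont i hi)) (fun x _ => ?_) (fun {x} hx => ?_)
        (Set.left_mem_Icc.2 (ht i.le_succ)) hu
      · simp [mul_pow, hsign, hs, hqG]
      · exact mul_ne_zero (by simp) (hne i hi x hx)
    intro i
    induction i with
    | zero => intro _; exact step 0 (Nat.zero_le _) _ (by simpa using hρ)
    | succ i ih =>
      intro hi
      refine step _ hi _ ?_
      have hm : t (i + 1) ∈ Set.Icc (t i) (t (i + 1)) := Set.right_mem_Icc.2 (ht i.le_succ)
      rw [ih (by omega) _ hm, hσ _ _ (hgood i (by omega)) (hgood _ hi) (γ (t (i + 1)))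
        ⟨hbox i (by omega) _ hm, hbox _ hi _ (Set.left_mem_Icc.2 (ht (i + 1).le_succ))⟩,
        Finset.prod_range_succ]
      push_cast
      ring
  rw [key m le_rfl _ (Set.left_mem_Icc.2 (ht m.le_succ)), hρ, hcm, hγm]
  push_cast
  ring

/-! ### The model link -/

/-- A complex function on `ℝ³` whose zero set is the blue circle with centre `(4j + 1, 0, 0)`; its
argument measures the winding of a loop around that circle. -/
noncomputable def blueFun {n : ℕ} (j : Fin n) (x : E3) : ℂ :=
  ⟨(x 0 - (4 * (j : ℝ) + 1)) ^ 2 + x 1 ^ 2 + x 2 ^ 2 - 1, 2 * x 1⟩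

theorem continuous_blueFun {n : ℕ} (j : Fin n) : Continuous (blueFun j) := by
  have : blueFun j = fun x : E3 => Complex.equivRealProdCLM.symm
      ((x 0 - (4 * (j : ℝ) + 1)) ^ 2 + x 1 ^ 2 + x 2 ^ 2 - 1, 2 * x 1) := rfl
  rw [this]
  fun_prop

theorem mem_range_hopfBlue_of_blueFun_eq_zero {n : ℕ} {j : Fin n} {x : E3} (h : blueFun j x = 0) :
    x ∈ Set.range (hopfBlue j) := by
  have h1 : 2 * x 1 = 0 := congrArg Complex.im h
  have h0 : (x 0 - (4 * (j : ℝ) + 1)) ^ 2 + x 1 ^ 2 + x 2 ^ 2 - 1 = 0 := congrArg Complex.re h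
  have h1' : x 1 = 0 := by linarith
  refine ⟨⟨⟨x 0 - (4 * (j : ℝ) + 1), x 2⟩, ?_⟩, ?_⟩
  · rw [Submonoid.unitSphere, ← SetLike.mem_coe]
    change _ ∈ Metric.sphere (0 : ℂ) 1
    rw [mem_sphere_zero_iff_norm, ← sq_eq_sq₀ (norm_nonneg _) zero_le_one,
      ← Complex.normSq_eq_norm_sq, Complex.normSq_mk]
    rw [h1'] at h0
    linarith
  · ext i
    fin_cases i <;> simp [hopfBlue, h1']

theorem continuous_hopfRed {n : ℕ} (j : Fin n) : Continuous (hopfRed j) := by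
  refine (PiLp.continuous_toLp 2 _).comp (continuous_pi fun i => ?_)
  fin_cases i <;> simp <;> fun_prop

theorem blueFun_hopfRed {n : ℕ} (j k : Fin n) (z : Circle) :
    blueFun j (hopfRed k z) =
      ⟨(4 * (k : ℝ) - 4 * j - 1) ^ 2 + 2 * (4 * (k : ℝ) - 4 * j - 1) * (z : ℂ).re,
        2 * (z : ℂ).im⟩ := by
  have hz : (z : ℂ).re ^ 2 + (z : ℂ).im ^ 2 = 1 := by
    have := Circle.normSq_coe z
    rw [Complex.normSq_apply] at this
    linarith
  apply Complex.ext
  · simp [blueFun, hopfRed]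
    linear_combination hz
  · simp [blueFun, hopfRed]

/-- Along a red circle that does not link the `j`-th blue circle, `blueFun j` has a continuous
square root. -/
theorem exists_sqrt_blueFun_of_ne {n : ℕ} {j k : Fin n} (h : k ≠ j) :
    ∃ q : Circle → ℂ, Continuous q ∧ (∀ z, q z ^ 2 = blueFun j (hopfRed k z)) ∧ ∀ z, q z ≠ 0 := by
  -- The values of `blueFun j` on this circle have positive real part.
  have hslit : ∀ z, blueFun j (hopfRed k z) ∈ Complex.slitPlane := fun z => by
    refine Complex.mem_slitPlane_iff.2 (Or.inl ?_)
    rw [blueFun_hopfRed]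
    have hre := abs_le.1 ((Complex.abs_re_le_norm (z : ℂ)).trans_eq z.norm_coe)
    rcases lt_or_gt_of_ne h with h | h
    · have : (k : ℝ) + 1 ≤ j := by exact_mod_cast h
      nlinarith
    · have : (j : ℝ) + 1 ≤ k := by exact_mod_cast h
      nlinarith
  refine ⟨fun z => blueFun j (hopfRed k z) ^ (1 / 2 : ℂ), ?_, fun z => ?_, fun z h0 => ?_⟩
  · exact ((continuous_blueFun j).comp (continuous_hopfRed k)).cpow continuous_const hslit
  · rw [← Complex.cpow_mul_nat]; simp
  · exact Complex.slitPlane_ne_zero (hslit z) ((Complex.cpow_eq_zero_iff _ _).1 h0).1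

/-- Along the red circle that links the `j`-th blue circle, a continuous square root of
`blueFun j` changes its sign. -/
theorem exists_sqrt_blueFun_self {n : ℕ} (j : Fin n) :
    ∃ q : ℝ → ℂ, Continuous q ∧
      (∀ t, q t ^ 2 = blueFun j (hopfRed j (Circle.exp (2 * Real.pi * t)))) ∧
      q 1 = -q 0 ∧ q 0 ≠ 0 := by
  -- With `w = exp (2πit)` the function is `1 - 2w⁻¹ = -2w⁻¹ (1 - w / 2)`, where `1 - w / 2` has
  -- positive real part.
  refine ⟨fun t => Complex.I * (Real.sqrt 2 : ℝ) * Complex.exp (-(Real.pi * t * Complex.I)) *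
      (1 - (Circle.exp (2 * Real.pi * t) : ℂ) / 2) ^ (1 / 2 : ℂ), ?_, fun t => ?_, ?_, ?_⟩
  · refine Continuous.mul (by fun_prop) (Continuous.cpow (by fun_prop) continuous_const fun t => ?_)
    refine Complex.mem_slitPlane_iff.2 (Or.inl ?_)
    have hre := abs_le.1 ((Complex.abs_re_le_norm (Circle.exp (2 * Real.pi * t) : ℂ)).trans_eq
      (Circle.norm_coe _))
    rw [Complex.sub_re, Complex.div_ofNat_re, Complex.one_re]
    linarith
  · beta_reduce
    rw [blueFun_hopfRed]
    generalize hw : Circle.exp (2 * Real.pi * t) = w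
    have hw1 : (w : ℂ) * (starRingEnd ℂ) w = 1 := by
      rw [Complex.mul_conj, Circle.normSq_coe]; simp
    have he : Complex.exp (-(Real.pi * t * Complex.I)) ^ 2 = (starRingEnd ℂ) w := by
      rw [← hw, Circle.coe_exp, ← Complex.exp_conj, ← Complex.exp_nat_mul]
      congr 1
      simp only [map_mul, Complex.conj_ofReal, Complex.conj_I]
      push_cast
      ring
    have h2 : (((Real.sqrt 2 : ℝ) : ℂ)) ^ 2 = 2 := by
      rw [← Complex.ofReal_pow, Real.sq_sqrt (by norm_num)]; norm_num
    rw [mul_pow, mul_pow, mul_pow, he, h2, Complex.I_sq, ← Complex.cpow_mul_nat]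
    have : (-1 * 2 * (starRingEnd ℂ) w) * (1 - (w : ℂ) / 2) = 1 - 2 * (starRingEnd ℂ) w := by
      linear_combination hw1
    simp only [one_div, Nat.cast_ofNat, ne_eq, OfNat.ofNat_ne_zero, not_false_eq_true,
      inv_mul_cancel₀, Complex.cpow_one]
    rw [this]
    apply Complex.ext <;> simp
    ring
  · simp [Complex.exp_neg, Complex.exp_pi_mul_I]
  · simp [Complex.cpow_eq_zero_iff]
    norm_num

/-! ### Counting -/

/-- A product of signs along a sequence depends only on the parities of the numbers of times that
the terms of the sequence occur. -/
theorem prod_eq_of_card_fiber_eq {E : Type*} [Fintype E] [DecidableEq E] (f : E → ℤˣ)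
    {m m' : ℕ} {e e' : ℕ → E}
    (h : ∀ a, ((((Finset.range m).filter fun i => e i = a).card : ℕ) : ZMod 2) =
      ((((Finset.range m').filter fun i => e' i = a).card : ℕ) : ZMod 2)) :
    ∏ i ∈ Finset.range m, f (e i) = ∏ i ∈ Finset.range m', f (e' i) := by
  rw [← Finset.prod_fiberwise' _ e, ← Finset.prod_fiberwise' _ e']
  refine Finset.prod_congr rfl fun a _ => ?_
  rw [Finset.prod_const, Finset.prod_const, Int.units_pow_eq_pow_mod_two,
    (ZMod.natCast_eq_natCast_iff' _ _ _).1 (h a), ← Int.units_pow_eq_pow_mod_two]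

/-- The count for an arbitrary homeomorphic image of the model in the cube, in terms of the number
`N` of cells along an edge of the cube. -/
theorem card_le_of_homeomorph (N n : ℕ) (φ : E3 ≃ₜ E3)
    (hr : ∀ (j : Fin n) z, φ (hopfRed j z) ∈ unitCube)
    (hb : ∀ (j : Fin n) z, φ (hopfBlue j z) ∈ unitCube)
    (hd : ∀ (j : Fin n) z w, 7 ≤ (N : ℝ) * dist (φ (hopfRed j z)) (φ (hopfBlue j w))) :
    (n : ℝ) ≤ Real.exp (28 * ((N : ℝ) + 1) ^ 3) := by
  classical
  set γ : Fin n → ℝ → E3 := fun k t => φ (hopfRed k (Circle.exp (2 * Real.pi * t))) with hγdef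
  have hγ : ∀ k, Continuous (γ k) := fun k =>
    φ.continuous.comp ((continuous_hopfRed k).comp (by fun_prop))
  have hγ1 : ∀ k, γ k 1 = γ k 0 := fun k => by simp [hγdef]
  choose m hm hsub using fun k => exists_subdivision N (hγ k)
  have he : ∀ k (i : ℕ), ∃ e : CubeStep N, i ≤ m k →
      e.1.toLattice = latticeCell N (γ k (i / m k)) ∧
      e.target = latticeCell N (γ k ((i + 1 : ℕ) / m k)) := by
    intro k i
    by_cases hi : i ≤ m k
    · obtain ⟨e, he⟩ := exists_cubeStep N (hr k _) (hsub k i hi).2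
      exact ⟨e, fun _ => he⟩
    · exact ⟨(fun _ => 0, fun _ => 0), fun h => absurd h hi⟩
  choose e he using he
  let key : Fin n → (CubeStep N → ZMod 2) × Set (CubeCell N) := fun k =>
    (fun a => (((Finset.range (m k)).filter fun i => e k i = a).card : ℕ),
      {v | ∃ z, v.toLattice = latticeCell N (φ (hopfBlue k z))})
  have hinj : Function.Injective key := by
    intro j k hjk
    by_contra hne
    have h1 := fun a => congrFun (congrArg Prod.fst hjk) a
    have h2 : ∀ v : CubeCell N, (∃ z, v.toLattice = latticeCell N (φ (hopfBlue j z))) →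
        ∃ z, v.toLattice = latticeCell N (φ (hopfBlue k z)) := fun v hv =>
      (Set.ext_iff.1 (congrArg Prod.snd hjk) v).1 hv
    obtain ⟨σ, hσ⟩ := exists_sign_cochain N ((continuous_blueFun j).comp φ.symm.continuous)
    -- The monodromy of the square root along `γ l`, for any `l` whose blue circle visits the same
    -- cells as the `j`-th one.
    have hmon : ∀ l, (∀ v : CubeCell N, (∃ z, v.toLattice = latticeCell N (φ (hopfBlue j z))) →
        ∃ z, v.toLattice = latticeCell N (φ (hopfBlue l z))) → ∀ q : ℝ → ℂ, Continuous q →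
        (∀ t, q t ^ 2 = blueFun j (hopfRed l (Circle.exp (2 * Real.pi * t)))) →
        q 1 = ((∏ i ∈ Finset.range (m l), σ (e l i).1.toLattice (e l i).target : ℤˣ) : ℤ) *
          q 0 := by
      intro l hl q hq hq2
      have hm0 : ((m l : ℕ) : ℝ) ≠ 0 := by exact_mod_cast (hm l).ne'
      have := hσ (γ l) q (fun i => i / m l) (fun i => latticeCell N (γ l (i / m l))) (m l)
        (hγ l) hq (fun t => by simp [hγdef, hq2])
        (fun a b hab => by dsimp only; gcongr) (fun i hi => (hsub l i hi).1) ?_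
        (by simp [hm0, hγ1]) (by simp [hm0, hγ1])
      · simp only [div_self hm0, Nat.cast_zero, zero_div] at this
        refine this.trans (congrArg (fun u : ℤˣ => ((u : ℤ) : ℂ) * q 0)
          (Finset.prod_congr rfl fun i hi => ?_))
        obtain ⟨h, h'⟩ := he l i (Finset.mem_range.1 hi).le
        rw [h, h']
      · intro i hi x hx h0
        obtain ⟨z, hz⟩ := mem_range_hopfBlue_of_blueFun_eq_zero h0
        have hxz : x = φ (hopfBlue j z) := by rw [hz]; simp
        obtain ⟨v, hv⟩ := exists_cubeCell N (hb j z)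
        obtain ⟨w, hw⟩ := hl v ⟨z, hv⟩
        refine (hd l (Circle.exp (2 * Real.pi * (i / m l))) w).not_gt ?_
        exact mul_dist_lt_seven hx (by rw [← hw, hv, hxz])
    obtain ⟨q, hq, hq2, hq1, hq0⟩ := exists_sqrt_blueFun_self j
    obtain ⟨s, hs, hs2, hs0⟩ := exists_sqrt_blueFun_of_ne (Ne.symm hne)
    have hj := hmon j (fun _ h => h) q hq hq2
    have hk := hmon k h2 (fun t => s (Circle.exp (2 * Real.pi * t))) (by fun_prop)
      (fun t => hs2 _)
    rw [prod_eq_of_card_fiber_eq (fun a : CubeStep N => σ a.1.toLattice a.target) h1] at hj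
    rw [hq1] at hj
    rcases Int.units_eq_one_or
      (∏ i ∈ Finset.range (m k), σ (e k i).1.toLattice (e k i).target) with h | h
    · rw [h] at hj
      exact hq0 (by simpa [neg_eq_self] using hj)
    · rw [h] at hk
      exact hs0 _ (by simpa [self_eq_neg] using hk)
  have hcard := Fintype.card_le_of_injective key hinj
  simp only [Fintype.card_fin, Fintype.card_prod, Fintype.card_set, Fintype.card_fun, ZMod.card]
    at hcard
  rw [← pow_add] at hcard
  calc (n : ℝ) ≤ (2 : ℝ) ^ _ := by exact_mod_cast hcard
    _ ≤ Real.exp 1 ^ _ := pow_le_pow_left₀ zero_le_two (by linarith [Real.add_one_le_exp 1]) _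
    _ = Real.exp (28 * ((N : ℝ) + 1) ^ 3) := by
        rw [← Real.exp_nat_mul]
        congr 1
        push_cast
        ring

theorem add_two_pow_three_le {y : ℝ} (hy : 0 < y) : (y + 2) ^ 3 ≤ 4 * (y ^ 3 + 8) := by
  nlinarith [mul_nonneg (add_pos hy two_pos).le (sq_nonneg (y - 2))]

theorem theorem1 :
    ∃ a : ℝ, 0 < a ∧ ∃ C : ℝ, 0 < C ∧ ∀ ε : ℝ, 0 < ε →
      ∀ (n : ℕ) (r b : Fin n → Circle → E3), IsDiagonalEmbedding ε r b →
        (n : ℝ) ≤ C * Real.exp (a * ε ^ (-3 : ℤ)) := by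
  refine ⟨28 * 4 * 343, by norm_num, Real.exp (28 * 4 * 8), Real.exp_pos _,
    fun ε hε n r b h => ?_⟩
  -- The circles `Φ 1 ∘ hopfRed j` and `r j` may be parametrized differently; only their images
  -- matter.
  obtain ⟨Φ, -, -, hΦ⟩ := h.linkType
  have hred : ∀ j z, ∃ w, r j w = Φ 1 (hopfRed j z) := fun j z => by
    have := (hΦ (Sum.inl j)).subset ⟨_, ⟨z, rfl⟩, rfl⟩
    simpa [hopfSplitUnion] using this
  have hblue : ∀ j z, ∃ w, b j w = Φ 1 (hopfBlue j z) := fun j z => by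
    have := (hΦ (Sum.inr j)).subset ⟨_, ⟨z, rfl⟩, rfl⟩
    simpa [hopfSplitUnion] using this
  have hN : 7 ≤ (⌈7 / ε⌉₊ : ℝ) * ε := (div_le_iff₀ hε).1 (Nat.le_ceil _)
  have hn := card_le_of_homeomorph ⌈7 / ε⌉₊ n (Φ 1).toHomeomorph
    (fun j z => by
      obtain ⟨w, hw⟩ := hred j z
      exact hw ▸ h.red_mem j w)
    (fun j z => by
      obtain ⟨w, hw⟩ := hblue j z
      exact hw ▸ h.blue_mem j w)
    (fun j z w => by
      obtain ⟨z', hz⟩ := hred j z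
      obtain ⟨w', hw⟩ := hblue j w
      refine hN.trans (mul_le_mul_of_nonneg_left ?_ (Nat.cast_nonneg _))
      have := h.le_dist j z' w'
      rw [hz, hw] at this
      exact this)
  have hN' : (⌈7 / ε⌉₊ : ℝ) + 1 ≤ 7 / ε + 2 := by
    have := Nat.ceil_lt_add_one (show 0 ≤ 7 / ε by positivity)
    linarith
  clear hN
  generalize ⌈7 / ε⌉₊ = N at hn hN'
  have hcube : ((N : ℝ) + 1) ^ 3 ≤ 4 * (343 * ε ^ (-3 : ℤ) + 8) := by
    have hε3 : 343 * ε ^ (-3 : ℤ) = (7 / ε) ^ 3 := by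
      rw [div_pow, zpow_neg, zpow_ofNat, div_eq_mul_inv]; norm_num
    rw [hε3]
    exact le_trans (by gcongr) (add_two_pow_three_le (by positivity))
  rw [← Real.exp_add]
  exact hn.trans (Real.exp_le_exp.2 (by linarith))
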